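/- **Theorem 2.4.** Let $G$ be a discrete group acting on a unital C*-algebra $A$ by $*$-automorphisms, $\alpha : G \to \mathrm{Aut}(A)$. Let $A \rtimes G$ and $A \rtimes_r G$ be the full and the reduced crossed product, each with its canonical copy of $A$. A unital inclusion $A \subseteq B$ of unital C*-algebras has the *pure extension property* (PEP) if every pure state on $A$ extends uniquely to a state on $B$ (which is then automatically pure). Let $\widehat{A}$ be the spectrum of $A$, i.e. the set of unitary equivalence classes $[\pi]$ of non-zero irreducible representations $\pi$ of $A$, and let $G$ act on $\widehat{A}$ by $g\cdot[\pi] = [\pi\circ\alpha_g]$. This action is *free* if $\{[\pi]\in\widehat{A} : [\pi\circ\alpha_g]=[\pi]\}=\emptyset$ for every $g \in G$ with $g \neq e$. Then the following are equivalent: (i) $A \subseteq A \rtimes G$ has the PEP; (ii) $A \subseteq A \rtimes_r G$ has the PEP; (iii) the action of $G$ on $\widehat{A}$ is free. -/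

import Mathlib

open scoped ENNReal ComplexOrder

noncomputable section

namespace CrossedPEP

universe u v w t

/-! ### States, pure states, and the pure extension property -/

section States

variable {A : Type u} [CStarAlgebra A] {B : Type v} [CStarAlgebra B]

/-- The state space of a unital C⋆-algebra: (automatically bounded) linear functionals that are
positive and unital. -/
def stateSpace (A : Type u) [CStarAlgebra A] : Set (StrongDual ℂ A) :=
  {φ | φ 1 = 1 ∧ ∀ a : A, 0 ≤ φ (star a * a)}

/-- The pure states: the extreme points of the (convex) state space. -/
def pureStates (A : Type u) [CStarAlgebra A] : Set (StrongDual ℂ A) :=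
  (stateSpace A).extremePoints ℝ

/-- The pure extension property of `A ⊆ B`, where `A` is viewed inside `B` through the unital
`*`-homomorphism `ι`: every pure state of `A` extends to exactly one state of `B`. (A unique
state extension of a pure state is automatically pure.) -/
def HasPEP (ι : A →⋆ₐ[ℂ] B) : Prop :=
  ∀ φ ∈ pureStates A, ∃! Φ : StrongDual ℂ B, Φ ∈ stateSpace B ∧ ∀ a : A, Φ (ι a) = φ a

end States

/-! ### Representations and the spectrum -/

/-- A unital representation of `A` on a Hilbert space. -/
structure Rep (A : Type u) [CStarAlgebra A] where
  H : Type w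
  [normed : NormedAddCommGroup H]
  [inner : InnerProductSpace ℂ H]
  [complete : CompleteSpace H]
  /-- the `*`-homomorphism into `B(H)` -/
  π : A →⋆ₐ[ℂ] (H →L[ℂ] H)

attribute [instance] Rep.normed Rep.inner Rep.complete

variable {A : Type u} [CStarAlgebra A]

/-- `π` is a non-zero irreducible representation: `H ≠ 0` and the only closed invariant subspaces
are `0` and `H`. (Non-zero irreducible representations of a unital C⋆-algebra are unital, so
nothing is lost by working with unital ones.) -/
structure Rep.IsIrreducible (π : Rep.{u, w} A) : Prop where
  nontrivial : Nontrivial π.H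
  eq_bot_or_eq_top : ∀ K : Submodule ℂ π.H, IsClosed (K : Set π.H) →
    (∀ a : A, ∀ x ∈ K, π.π a x ∈ K) → K = ⊥ ∨ K = ⊤

/-- Unitary equivalence of representations. -/
def Rep.UnitaryEquiv (π σ : Rep.{u, w} A) : Prop :=
  ∃ U : π.H ≃ₗᵢ[ℂ] σ.H, ∀ (a : A) (x : π.H), U (π.π a x) = σ.π a (U x)

/-- The representation `π ∘ β`, for a `*`-automorphism `β` of `A`. -/
def Rep.comp (π : Rep.{u, w} A) (β : A ≃⋆ₐ[ℂ] A) : Rep.{u, w} A where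
  H := π.H
  π := π.π.comp (β : A →⋆ₐ[ℂ] A)

theorem Rep.IsIrreducible.comp {π : Rep.{u, w} A} (h : π.IsIrreducible) (β : A ≃⋆ₐ[ℂ] A) :
    (π.comp β).IsIrreducible where
  nontrivial := h.nontrivial
  eq_bot_or_eq_top K hK hinv := h.eq_bot_or_eq_top K hK fun a x hx => by
    have hx' : π.π (β (β.symm a)) x ∈ K := hinv (β.symm a) x hx
    rwa [StarAlgEquiv.apply_symm_apply] at hx'

/-- The non-zero irreducible representations of `A`. Every irreducible representation is cyclic,
so up to unitary equivalence it lives on a Hilbert space in the universe of `A`. -/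
abbrev Irrep (A : Type u) [CStarAlgebra A] : Type (u + 1) :=
  {π : Rep.{u, u} A // π.IsIrreducible}

instance irrepSetoid (A : Type u) [CStarAlgebra A] : Setoid (Irrep A) where
  r π σ := π.1.UnitaryEquiv σ.1
  iseqv :=
    { refl := fun π => ⟨LinearIsometryEquiv.refl ℂ _, fun _ _ => rfl⟩
      symm := fun {π σ} ⟨U, hU⟩ => ⟨U.symm, fun a x => by
        apply U.injective
        rw [hU]
        simp⟩
      trans := fun {π σ τ} ⟨U, hU⟩ ⟨V, hV⟩ => ⟨U.trans V, fun a x => by simp [hU, hV]⟩ }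

/-- The spectrum `Â`, as a set: unitary equivalence classes of non-zero irreducible
representations. -/
def Spec (A : Type u) [CStarAlgebra A] : Type (u + 1) := Quotient (irrepSetoid A)

/-- The map `[π] ↦ [π ∘ β]` of the spectrum induced by a `*`-automorphism `β`. -/
def Spec.precomp (β : A ≃⋆ₐ[ℂ] A) : Spec A → Spec A :=
  Quotient.map (fun π : Irrep A => (⟨π.1.comp β, π.2.comp β⟩ : Irrep A))
    (fun _ _ ⟨U, hU⟩ => ⟨U, fun a x => hU (β a) x⟩)

variable {G : Type v} [Group G]

/-- The induced action `g · [π] = [π ∘ α g]` on the spectrum is free: no `g ≠ e` fixes a point. -/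
def IsFreeOnSpec (α : G →* (A ≃⋆ₐ[ℂ] A)) : Prop :=
  ∀ g : G, g ≠ 1 → {x : Spec A | Spec.precomp (α g) x = x} = ∅

/-! ### Operators on Hilbert direct sums -/

section DirectSum

variable {I : Type t} {H : I → Type w} [∀ i, NormedAddCommGroup (H i)]

theorem memℓp_of_norm_le {H' : I → Type w} [∀ i, NormedAddCommGroup (H' i)] (C : ℝ)
    (x : lp H 2) (y : ∀ i, H' i) (h : ∀ i, ‖y i‖ ≤ C * ‖x i‖) : Memℓp y 2 := by
  have hx := (lp.memℓp x).summable (by norm_num)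
  refine memℓp_gen (Summable.of_nonneg_of_le (fun i => by positivity) (fun i => ?_)
    (hx.mul_left (C ^ 2)))
  simp only [ENNReal.toReal_ofNat, Real.rpow_ofNat]
  rw [← mul_pow]
  exact pow_le_pow_left₀ (norm_nonneg _) (h i) 2

theorem norm_sq_eq_tsum (x : lp H 2) : ‖x‖ ^ 2 = ∑' i, ‖x i‖ ^ 2 := by
  have := lp.norm_rpow_eq_tsum (p := 2) (by norm_num) x
  simpa using this

theorem summable_norm_sq (x : lp H 2) : Summable fun i => ‖x i‖ ^ 2 := by
  have := (lp.memℓp x).summable (by norm_num)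
  simpa using this

variable [∀ i, InnerProductSpace ℂ (H i)]

/-- The diagonal operator `⨁ T i` of a uniformly bounded family. -/
def diagOp (T : ∀ i, H i →L[ℂ] H i) (C : ℝ) (hC : 0 ≤ C) (hT : ∀ i, ‖T i‖ ≤ C) :
    lp H 2 →L[ℂ] lp H 2 :=
  LinearMap.mkContinuous
    { toFun := fun x => ⟨fun i => T i (x i),
        memℓp_of_norm_le C x _ fun i => (T i).le_of_opNorm_le (hT i) _⟩
      map_add' := fun x y => by ext i; simp; rfl
      map_smul' := fun c x => by ext i; simp }
    C (fun x => by
      refine le_of_sq_le_sq ?_ (by positivity)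
      rw [mul_pow, norm_sq_eq_tsum, norm_sq_eq_tsum, ← tsum_mul_left]
      refine Summable.tsum_le_tsum (fun i => ?_) (summable_norm_sq _)
        ((summable_norm_sq x).mul_left _)
      rw [← mul_pow]
      exact pow_le_pow_left₀ (norm_nonneg _) ((T i).le_of_opNorm_le (hT i) _) 2)

@[simp]
theorem diagOp_apply (T : ∀ i, H i →L[ℂ] H i) (C : ℝ) (hC : 0 ≤ C) (hT : ∀ i, ‖T i‖ ≤ C)
    (x : lp H 2) (i : I) : diagOp T C hC hT x i = T i (x i) := rfl

/-- The direct sum `⨁ φ i` of a family of unital representations, on the Hilbert direct sum. -/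
def diagRep [∀ i, CompleteSpace (H i)] (φ : ∀ i, A →⋆ₐ[ℂ] (H i →L[ℂ] H i)) : A →⋆ₐ[ℂ] (lp H 2 →L[ℂ] lp H 2) where
  toFun a := diagOp (fun i => φ i a) ‖a‖ (norm_nonneg a)
    fun i => NonUnitalStarAlgHom.norm_apply_le (φ i) a
  map_one' := by ext x i; simp
  map_mul' a b := by ext x i; simp
  map_zero' := by ext x i; simp
  map_add' a b := by ext x i; simp
  commutes' c := by ext x i; simp [Algebra.algebraMap_eq_smul_one]
  map_star' a := by
    rw [ContinuousLinearMap.star_eq_adjoint, ContinuousLinearMap.eq_adjoint_iff]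
    intro x y
    rw [lp.inner_eq_tsum, lp.inner_eq_tsum]
    refine tsum_congr fun i => ?_
    change inner ℂ (φ i (star a) (x i)) (y i) = inner ℂ (x i) (φ i a (y i))
    rw [map_star, ContinuousLinearMap.star_eq_adjoint, ContinuousLinearMap.adjoint_inner_left]

@[simp]
theorem diagRep_apply [∀ i, CompleteSpace (H i)] (φ : ∀ i, A →⋆ₐ[ℂ] (H i →L[ℂ] H i)) (a : A) (x : lp H 2) (i : I) :
    diagRep φ a x i = φ i a (x i) := rfl

/-- The direct sum `⨁ U i` of a family of unitary representations of `G`. -/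
def diagUnitary (U : ∀ i, G →* (H i ≃ₗᵢ[ℂ] H i)) : G →* (lp H 2 ≃ₗᵢ[ℂ] lp H 2) where
  toFun g :=
    { toFun := fun x => ⟨fun i => U i g (x i), memℓp_of_norm_le 1 x _ fun i => by simp⟩
      invFun := fun x => ⟨fun i => U i g⁻¹ (x i), memℓp_of_norm_le 1 x _ fun i => by simp⟩
      left_inv := fun x => by
        ext i
        change (U i g⁻¹ * U i g) (x i) = x i
        rw [← map_mul]; simp
      right_inv := fun x => by
        ext i
        change (U i g * U i g⁻¹) (x i) = x i
        rw [← map_mul]; simp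
      map_add' := fun x y => by ext i; simp; rfl
      map_smul' := fun c x => by ext i; simp
      norm_map' := fun x => by
        refine (sq_eq_sq₀ (norm_nonneg _) (norm_nonneg _)).1 ?_
        rw [norm_sq_eq_tsum, norm_sq_eq_tsum]
        exact tsum_congr fun i => by simp }
  map_one' := by ext x i; simp
  map_mul' g h := by ext x i; simp

@[simp]
theorem diagUnitary_apply (U : ∀ i, G →* (H i ≃ₗᵢ[ℂ] H i)) (g : G) (x : lp H 2) (i : I) :
    diagUnitary U g x i = U i g (x i) := rfl

end DirectSum

/-- The left translation `(λ_g ζ)(h) = ζ(g⁻¹ h)` on `ℓ²(G, H)`. -/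
def translation (G : Type v) [Group G] (H : Type w) [NormedAddCommGroup H]
    [InnerProductSpace ℂ H] :
    G →* (lp (fun _ : G => H) 2 ≃ₗᵢ[ℂ] lp (fun _ : G => H) 2) :=
  have key : ∀ (g : G) (x : lp (fun _ : G => H) 2),
      Memℓp (fun h => x (g⁻¹ * h)) 2 := fun g x =>
    memℓp_gen (((Equiv.mulLeft g⁻¹).summable_iff).2 ((lp.memℓp x).summable (by norm_num)))
  { toFun := fun g =>
      { toFun := fun x => ⟨fun h => x (g⁻¹ * h), key g x⟩
        invFun := fun x => ⟨fun h => x (g⁻¹⁻¹ * h), key g⁻¹ x⟩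
        left_inv := fun x => by ext h; simp
        right_inv := fun x => by ext h; simp
        map_add' := fun x y => by ext h; simp; rfl
        map_smul' := fun c x => by ext h; simp
        norm_map' := fun x => by
          refine (sq_eq_sq₀ (norm_nonneg _) (norm_nonneg _)).1 ?_
          rw [norm_sq_eq_tsum, norm_sq_eq_tsum]
          exact (Equiv.mulLeft g⁻¹).tsum_eq fun h => ‖x h‖ ^ 2 }
    map_one' := by ext x h; simp
    map_mul' := fun g k => by ext x h; simp [mul_assoc] }

@[simp]
theorem translation_apply (H : Type w) [NormedAddCommGroup H] [InnerProductSpace ℂ H]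
    (g : G) (x : lp (fun _ : G => H) 2) (h : G) : translation G H g x h = x (g⁻¹ * h) := rfl

/-! ### Covariant representations and crossed products -/

/-- A covariant representation `(π, U)` of `(A, G, α)` on a Hilbert space: `π` is a unital
representation of `A`, `U` a unitary representation of `G`, and `U_g π(a) U_g* = π(α_g(a))`. -/
structure CovariantRep (α : G →* (A ≃⋆ₐ[ℂ] A)) extends Rep.{u, w} A where
  U : G →* (H ≃ₗᵢ[ℂ] H)
  covariant : ∀ (g : G) (a : A) (x : H), U g (π a x) = π (α g a) (U g x)

namespace CovariantRep

variable {α : G →* (A ≃⋆ₐ[ℂ] A)}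

/-- The unitary `U_g`, as a bounded operator. -/
def unitaryOp (ρ : CovariantRep.{u, v, w} α) (g : G) : ρ.H →L[ℂ] ρ.H :=
  ((ρ.U g).toContinuousLinearEquiv : ρ.H →L[ℂ] ρ.H)

/-- The C⋆-algebra generated by `π(A)` and `U(G)`, i.e. the norm closure of the `*`-algebra
`{∑ π(a_g) U_g}`. -/
def algebra (ρ : CovariantRep.{u, v, w} α) : StarSubalgebra ℂ (ρ.H →L[ℂ] ρ.H) :=
  (StarAlgebra.adjoin ℂ (Set.range ρ.π ∪ Set.range ρ.unitaryOp)).topologicalClosure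

instance (ρ : CovariantRep.{u, v, w} α) : CStarAlgebra ρ.algebra :=
  StarSubalgebra.cstarAlgebra ρ.algebra
    (h_closed := StarSubalgebra.isClosed_topologicalClosure _)

/-- The canonical map `a ↦ π(a)` from `A` to the C⋆-algebra generated by `(π, U)`. -/
def incl (ρ : CovariantRep.{u, v, w} α) : A →⋆ₐ[ℂ] ρ.algebra :=
  ρ.π.codRestrict ρ.algebra fun a =>
    StarSubalgebra.le_topologicalClosure _
      (StarAlgebra.subset_adjoin ℂ _ (Or.inl ⟨a, rfl⟩))

/-- The Hilbert direct sum of a family of covariant representations. -/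
def directSum {I : Type t} (ρ : I → CovariantRep.{u, v, w} α) :
    CovariantRep.{u, v, max t w} α where
  H := lp (fun i => (ρ i).H) 2
  π := diagRep fun i => (ρ i).π
  U := diagUnitary fun i => (ρ i).U
  covariant g a x := by
    ext i
    simp [(ρ i).covariant]

/-- The regular covariant representation on `ℓ²(G, H)` induced by a representation `π` of `A` on
`H`: `(π̃(a) ζ)(h) = π(α_{h⁻¹}(a)) ζ(h)` and `(λ_g ζ)(h) = ζ(g⁻¹ h)`. -/
def regular (α : G →* (A ≃⋆ₐ[ℂ] A)) (π : Rep.{u, w} A) : CovariantRep.{u, v, max v w} α where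
  H := lp (fun _ : G => π.H) 2
  π := diagRep fun h => π.π.comp (α h⁻¹ : A →⋆ₐ[ℂ] A)
  U := translation G π.H
  covariant g a x := by
    ext h
    simp

end CovariantRep

/-- The universal covariant representation: the direct sum of all covariant representations. The
norm of `∑ a_g g` in it is the supremum of `‖∑ π(a_g) U_g‖` over all covariant representations
`(π, U)`; since cyclic ones suffice, Hilbert spaces in the universe of `A` and `G` suffice. -/
def fullRep (α : G →* (A ≃⋆ₐ[ℂ] A)) :
    CovariantRep.{u, v, max (u + 1) (v + 1)} α :=
  CovariantRep.directSum fun ρ : CovariantRep.{u, v, max u v} α => ρ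

/-- The direct sum of the regular representations induced by all representations of `A`. The norm
of `∑ a_g g` in it is the supremum over all `π` of its norm in the regular representation induced
by `π`, i.e. its norm in the regular representation induced by any faithful `π`. -/
def reducedRep (α : G →* (A ≃⋆ₐ[ℂ] A)) :
    CovariantRep.{u, v, max (u + 1) v} α :=
  CovariantRep.directSum fun π : Rep.{u, u} A => CovariantRep.regular α π

/-- The full crossed product `A ⋊ G`. -/
abbrev FullCrossedProduct (α : G →* (A ≃⋆ₐ[ℂ] A)) := (fullRep α).algebra

/-- The reduced crossed product `A ⋊_r G`. -/
abbrev ReducedCrossedProduct (α : G →* (A ≃⋆ₐ[ℂ] A)) := (reducedRep α).algebra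

/-- The canonical inclusion `A ⊆ A ⋊ G`. -/
def fullIncl (α : G →* (A ≃⋆ₐ[ℂ] A)) : A →⋆ₐ[ℂ] FullCrossedProduct α := (fullRep α).incl

/-- The canonical inclusion `A ⊆ A ⋊_r G`. -/
def reducedIncl (α : G →* (A ≃⋆ₐ[ℂ] A)) : A →⋆ₐ[ℂ] ReducedCrossedProduct α := (reducedRep α).incl

end CrossedPEP

end

/-!
Both equivalences are instances of one statement about an arbitrary covariant representation `ρ`
that contains, up to unitary equivalence, all regular representations: `A` has the pure extension
property in the C⋆-algebra generated by `ρ` if and only if `G` acts freely on the spectrum of `A`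
(`CovariantRep.ContainsRegular.hasPEP_iff`). The representations defining the full and the reduced
crossed product both contain the regular ones as direct summands.

A pure state `φ` is a cyclic vector state of an irreducible representation `π`, with vector `ξ`, by
the GNS construction (`exists_gns`, `isIrreducible_of_mem_pureStates`). The vector `ξ ⊗ δ_e` of the
regular representation induced by `π` gives a state extension `Φ₀` of `φ`, and `Φ₀` vanishes at
`a U_g` for all `g ≠ e`.

Suppose that the action is free, and let `Φ` be any state extension of `φ`. The GNS space of `φ`
embeds into that of `Φ`, and the compression of `U_g` to it intertwines `π` and `π ∘ α_g`. For
`g ≠ e` these irreducible representations are inequivalent, so the compression is `0` by Schur's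
lemma (`Rep.IsIrreducible.unitaryEquiv`), and `Φ(a U_g) = 0`. The elements `a U_g` span a dense
subspace, so `Φ = Φ₀`.

Conversely, let `U` be a unitary equivalence of `π ∘ α_g` and `π` with `g ≠ e` and `π` irreducible.
For `|c| = 1`, the vector `(ξ ⊗ δ_e + c U⁻¹ξ ⊗ δ_{g⁻¹}) / √2` also extends the vector state of `ξ`,
which is pure. Uniqueness for both `c = 1` and `c = i` would make `U⁻¹ξ` orthogonal to the orbit
`π(A) ξ`, which is dense.
-/

noncomputable section

namespace CrossedPEP

open scoped InnerProductSpace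
open ContinuousLinearMap

/-! ### Vector functionals and the Gelfand–Naimark–Segal representation -/

section Representations

universe u w w'

variable {A : Type u} [CStarAlgebra A]
variable {H : Type w} [NormedAddCommGroup H] [InnerProductSpace ℂ H] [CompleteSpace H]
variable {K : Type w'} [NormedAddCommGroup K] [InnerProductSpace ℂ K] [CompleteSpace K]

theorem inner_map_star_right (π : A →⋆ₐ[ℂ] (H →L[ℂ] H)) (a : A) (x y : H) :
    ⟪x, π (star a) y⟫_ℂ = ⟪π a x, y⟫_ℂ := by
  rw [map_star, star_eq_adjoint, adjoint_inner_right]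

theorem map_mul_apply (π : A →⋆ₐ[ℂ] (H →L[ℂ] H)) (a b : A) (x : H) :
    π (a * b) x = π a (π b x) := by
  rw [map_mul, mul_apply_eq_comp]

/-- The linear map `a ↦ π(a) x`. -/
def orbitMap (π : A →⋆ₐ[ℂ] (H →L[ℂ] H)) (x : H) : A →ₗ[ℂ] H where
  toFun a := π a x
  map_add' a b := by simp
  map_smul' c a := by simp

@[simp]
theorem orbitMap_apply (π : A →⋆ₐ[ℂ] (H →L[ℂ] H)) (x : H) (a : A) : orbitMap π x a = π a x := rfl

/-- The functional `a ↦ ⟪x, π(a) x⟫`. -/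
def vectorFunctional (π : A →⋆ₐ[ℂ] (H →L[ℂ] H)) (x : H) : StrongDual ℂ A :=
  LinearMap.mkContinuous ((innerₛₗ ℂ x).comp (orbitMap π x)) (‖x‖ * ‖x‖) fun a => by
    calc ‖⟪x, π a x⟫_ℂ‖ ≤ ‖x‖ * ‖π a x‖ := norm_inner_le_norm _ _
      _ ≤ ‖x‖ * (‖a‖ * ‖x‖) := by
        gcongr
        exact (π a).le_of_opNorm_le (NonUnitalStarAlgHom.norm_apply_le π a) x
      _ = ‖x‖ * ‖x‖ * ‖a‖ := by ring

@[simp]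
theorem vectorFunctional_apply (π : A →⋆ₐ[ℂ] (H →L[ℂ] H)) (x : H) (a : A) :
    vectorFunctional π x a = ⟪x, π a x⟫_ℂ := rfl

theorem vectorFunctional_star_mul_self (π : A →⋆ₐ[ℂ] (H →L[ℂ] H)) (x : H) (a : A) :
    vectorFunctional π x (star a * a) = ((‖π a x‖ ^ 2 : ℝ) : ℂ) := by
  rw [vectorFunctional_apply, map_mul_apply, inner_map_star_right, inner_self_eq_norm_sq_to_K]
  norm_cast

theorem vectorFunctional_star_mul_self_nonneg (π : A →⋆ₐ[ℂ] (H →L[ℂ] H)) (x : H) (a : A) :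
    0 ≤ vectorFunctional π x (star a * a) := by
  rw [vectorFunctional_star_mul_self]
  exact Complex.zero_le_real.2 (sq_nonneg _)

theorem vectorFunctional_mem_stateSpace (π : A →⋆ₐ[ℂ] (H →L[ℂ] H)) {x : H} (hx : ‖x‖ = 1) :
    vectorFunctional π x ∈ stateSpace A := by
  refine ⟨?_, vectorFunctional_star_mul_self_nonneg π x⟩
  rw [vectorFunctional_apply, map_one]
  change ⟪x, x⟫_ℂ = 1
  simp [inner_self_eq_norm_sq_to_K, hx]

/-- The GNS representation of a state: every state is a vector state of a cyclic representation,
on a Hilbert space in the universe of the algebra. -/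
theorem exists_gns {φ : StrongDual ℂ A} (hφ : φ ∈ stateSpace A) :
    ∃ (π : Rep.{u, u} A) (ξ : π.H), ‖ξ‖ = 1 ∧ DenseRange (orbitMap π.π ξ) ∧
      vectorFunctional π.π ξ = φ := by
  let _ : PartialOrder A := CStarAlgebra.spectralOrder A
  have _ : StarOrderedRing A := CStarAlgebra.spectralOrderedRing A
  let f : A →ₚ[ℂ] ℂ := PositiveLinearMap.mk₀ φ.toLinearMap fun x hx => by
    obtain ⟨b, rfl⟩ := CStarAlgebra.nonneg_iff_eq_star_mul_self.1 hx
    exact hφ.2 b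
  have hf : ∀ a, f a = φ a := fun _ => rfl
  let ξ : f.GNS := ((f.toPreGNS 1 : f.PreGNS) : UniformSpace.Completion f.PreGNS)
  have horb : ∀ a, f.gnsStarAlgHom a ξ =
      ((f.toPreGNS a : f.PreGNS) : UniformSpace.Completion f.PreGNS) := fun a => by
    rw [PositiveLinearMap.gnsStarAlgHom_apply]
    change f.gnsNonUnitalStarAlgHom a _ = _
    rw [PositiveLinearMap.gnsNonUnitalStarAlgHom_apply_coe]
    simp
  have hvec : vectorFunctional f.gnsStarAlgHom ξ = φ := by
    ext a
    rw [vectorFunctional_apply, horb, UniformSpace.Completion.inner_coe,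
      PositiveLinearMap.preGNS_inner_def]
    simp [hf]
  refine ⟨⟨f.GNS, f.gnsStarAlgHom⟩, ξ, ?_, ?_, hvec⟩
  · have h1 := vectorFunctional_star_mul_self f.gnsStarAlgHom ξ 1
    rw [hvec, star_one, one_mul, hφ.1, map_one] at h1
    have h2 : ‖ξ‖ ^ 2 = 1 := Complex.ofReal_eq_one.1 h1.symm
    exact (sq_eq_sq₀ (norm_nonneg _) zero_le_one).1 (by rw [h2, one_pow])
  · have : ⇑(orbitMap f.gnsStarAlgHom ξ) =
        (fun y : f.PreGNS => (y : UniformSpace.Completion f.PreGNS)) ∘ f.toPreGNS :=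
      funext horb
    change DenseRange ⇑(orbitMap f.gnsStarAlgHom ξ)
    rw [this]
    exact UniformSpace.Completion.denseRange_coe.comp f.toPreGNS.surjective.denseRange
      (UniformSpace.Completion.continuous_coe _)

/-! ### Intertwiners and Schur's lemma -/

/-- If `‖σ(a) η‖ ≤ C ‖π(a) ξ‖` with `ξ` cyclic, then `π(a) ξ ↦ σ(a) η` extends to a bounded
intertwiner. -/
theorem exists_intertwiner (π : A →⋆ₐ[ℂ] (H →L[ℂ] H)) (σ : A →⋆ₐ[ℂ] (K →L[ℂ] K)) {ξ : H} {η : K}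
    (hξ : DenseRange (orbitMap π ξ)) (C : ℝ) (hC : ∀ a, ‖σ a η‖ ≤ C * ‖π a ξ‖) :
    ∃ R : H →L[ℂ] K, R ξ = η ∧ ∀ a x, R (π a x) = σ a (R x) := by
  let R : H →L[ℂ] K := (orbitMap σ η).extendOfNorm (orbitMap π ξ)
  have hR : ∀ a, R (π a ξ) = σ a η := fun a =>
    LinearMap.extendOfNorm_eq (f := orbitMap σ η) hξ ⟨C, hC⟩ a
  refine ⟨R, by simpa using hR 1, fun a x => ?_⟩
  refine congrFun (hξ.equalizer (g := fun x => R (π a x)) (h := fun x => σ a (R x))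
    (by fun_prop) (by fun_prop) (funext fun b => ?_)) x
  simp only [Function.comp_apply, orbitMap_apply]
  rw [← map_mul_apply, hR, hR, map_mul_apply]

theorem adjoint_intertwines {π : A →⋆ₐ[ℂ] (H →L[ℂ] H)} {σ : A →⋆ₐ[ℂ] (K →L[ℂ] K)} {T : H →L[ℂ] K}
    (hT : ∀ a x, T (π a x) = σ a (T x)) (a : A) (y : K) :
    adjoint T (σ a y) = π a (adjoint T y) := by
  refine ext_inner_left ℂ fun x => ?_
  rw [adjoint_inner_right, ← star_star a, inner_map_star_right, inner_map_star_right,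
    adjoint_inner_right, hT]

theorem Rep.IsIrreducible.denseRange_orbitMap {π : Rep.{u, w} A} (hπ : π.IsIrreducible) {x : π.H}
    (hx : x ≠ 0) : DenseRange (orbitMap π.π x) := by
  let L : Submodule ℂ π.H := (LinearMap.range (orbitMap π.π x)).topologicalClosure
  have hxL : x ∈ L := Submodule.le_topologicalClosure _ ⟨1, by simp⟩
  have hinv : ∀ a : A, ∀ y ∈ L, π.π a y ∈ L := fun a y hy => by
    refine map_mem_closure (π.π a).continuous hy ?_
    rintro _ ⟨b, rfl⟩
    exact ⟨a * b, by simp⟩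
  rcases hπ.eq_bot_or_eq_top L (Submodule.isClosed_topologicalClosure _) hinv with h | h
  · rw [h, Submodule.mem_bot] at hxL
    exact absurd hxL hx
  · have := (Submodule.dense_iff_topologicalClosure_eq_top).2 h
    rwa [LinearMap.coe_range] at this

/-- Schur's lemma: a self-adjoint operator commuting with an irreducible representation is a real
scalar. If its spectrum had two points, functions `f`, `g` with `f g = 0` that do not vanish on the
spectrum would make the kernel of `f(S)` a proper non-zero invariant subspace. -/
theorem Rep.IsIrreducible.exists_eq_algebraMap {π : Rep.{u, w} A} (hπ : π.IsIrreducible)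
    {S : π.H →L[ℂ] π.H} (hS : IsSelfAdjoint S) (hc : ∀ a, Commute S (π.π a)) :
    ∃ c : ℝ, S = algebraMap ℝ (π.H →L[ℂ] π.H) c := by
  have := hπ.nontrivial
  have hne : ∀ f : ℝ → ℝ, Continuous f → ∀ t ∈ spectrum ℝ S, f t ≠ 0 → cfc f S ≠ 0 := by
    intro f hf t ht hft h0
    have : f t ∈ spectrum ℝ (cfc f S) := by
      rw [cfc_map_spectrum f S hS hf.continuousOn]
      exact ⟨t, ht, rfl⟩
    rw [h0, spectrum.zero_eq] at this
    exact hft this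
  have key : ∀ s ∈ spectrum ℝ S, ∀ t ∈ spectrum ℝ S, ¬ s < t := by
    intro s hs t ht hst
    obtain ⟨m, hsm, hmt⟩ := exists_between hst
    let f : ℝ → ℝ := fun x => max (x - m) 0
    let g : ℝ → ℝ := fun x => max (m - x) 0
    have hf : Continuous f := by fun_prop
    have hg : Continuous g := by fun_prop
    have hf0 : cfc f S ≠ 0 := hne f hf t ht (lt_max_of_lt_left (sub_pos.2 hmt)).ne'
    have hg0 : cfc g S ≠ 0 := hne g hg s hs (lt_max_of_lt_left (sub_pos.2 hsm)).ne'
    have hfg : cfc f S * cfc g S = 0 := by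
      rw [← cfc_mul f g S hf.continuousOn hg.continuousOn]
      have : (fun x => f x * g x) = fun _ => 0 := by
        funext x
        rcases le_total x m with h | h
        · simp [f, max_eq_right (sub_nonpos.2 h)]
        · simp [g, max_eq_right (sub_nonpos.2 h)]
      rw [this, cfc_const_zero]
    have hinv : ∀ a : A, ∀ x ∈ LinearMap.ker (cfc f S).toLinearMap,
        π.π a x ∈ LinearMap.ker (cfc f S).toLinearMap := fun a x hx => by
      have hx' : cfc f S x = 0 := hx
      have h1 := congrArg (fun T : π.H →L[ℂ] π.H => T x) ((hc a).cfc_real f).eq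
      simp only [mul_apply_eq_comp, hx', map_zero] at h1
      exact h1
    rcases hπ.eq_bot_or_eq_top _ (cfc f S).isClosed_ker hinv with h | h
    · refine hg0 (ContinuousLinearMap.ext fun x => ?_)
      have hx : cfc g S x ∈ LinearMap.ker (cfc f S).toLinearMap := by
        simpa using congrArg (fun T : π.H →L[ℂ] π.H => T x) hfg
      rw [h, Submodule.mem_bot] at hx
      simpa using hx
    · refine hf0 (ContinuousLinearMap.ext fun x => ?_)
      have hx : x ∈ LinearMap.ker (cfc f S).toLinearMap := h ▸ Submodule.mem_top
      simpa using hx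
  obtain ⟨c, hcS⟩ := ContinuousFunctionalCalculus.spectrum_nonempty (R := ℝ) S hS
  exact ⟨c, CFC.eq_algebraMap_of_spectrum_subset_singleton S c
    (fun s hs => (not_lt.1 (key c hcS s hs)).antisymm (not_lt.1 (key s hs c hcS))) hS⟩

theorem Rep.IsIrreducible.exists_adjoint_apply_eq {π : Rep.{u, w} A} (hπ : π.IsIrreducible)
    {σ : A →⋆ₐ[ℂ] (K →L[ℂ] K)} {T : π.H →L[ℂ] K} (hT : ∀ a x, T (π.π a x) = σ a (T x)) :
    ∃ c : ℝ, ∀ x, adjoint T (T x) = (c : ℂ) • x := by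
  obtain ⟨c, hc⟩ := hπ.exists_eq_algebraMap (S := adjoint T ∘L T)
    (isPositive_adjoint_comp_self T).isSelfAdjoint fun a => by
      ext x
      simp [hT, adjoint_intertwines hT]
  refine ⟨c, fun x => ?_⟩
  have := congrArg (fun S : π.H →L[ℂ] π.H => S x) hc
  simpa [Algebra.algebraMap_eq_smul_one] using this

/-- A non-zero intertwiner of irreducible representations is a multiple of a unitary. -/
theorem Rep.IsIrreducible.unitaryEquiv {π σ : Rep.{u, w} A} (hπ : π.IsIrreducible)
    (hσ : σ.IsIrreducible) {T : π.H →L[ℂ] σ.H} (hT : ∀ a x, T (π.π a x) = σ.π a (T x))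
    (hT0 : T ≠ 0) : π.UnitaryEquiv σ := by
  obtain ⟨c, hc⟩ := hπ.exists_adjoint_apply_eq hT
  have hnorm : ∀ x, ‖T x‖ ^ 2 = c * ‖x‖ ^ 2 := fun x => by
    have h : ((‖T x‖ ^ 2 : ℝ) : ℂ) = ((c * ‖x‖ ^ 2 : ℝ) : ℂ) := by
      have h1 := inner_self_eq_norm_sq_to_K (𝕜 := ℂ) (T x)
      rw [← adjoint_inner_right, hc, inner_smul_right, inner_self_eq_norm_sq_to_K] at h1
      push_cast
      exact h1.symm
    exact_mod_cast h
  obtain ⟨x₀, hx₀⟩ : ∃ x, T x ≠ 0 := by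
    by_contra! h
    exact hT0 (ContinuousLinearMap.ext h)
  have hcpos : 0 < c := by
    have h1 : 0 < ‖T x₀‖ ^ 2 := by positivity
    rw [hnorm] at h1
    exact pos_of_mul_pos_left h1 (sq_nonneg _)
  have hs : 0 < √c := Real.sqrt_pos.2 hcpos
  let V : π.H →ₗᵢ[ℂ] σ.H :=
    { toLinearMap := (((√c)⁻¹ : ℝ) : ℂ) • T.toLinearMap
      norm_map' := fun x => by
        have h1 : ‖T x‖ = √c * ‖x‖ := by
          rw [← Real.sqrt_sq (norm_nonneg (T x)), hnorm, Real.sqrt_mul hcpos.le,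
            Real.sqrt_sq (norm_nonneg x)]
        change ‖(((√c)⁻¹ : ℝ) : ℂ) • T x‖ = ‖x‖
        rw [norm_smul, h1, Complex.norm_real, Real.norm_of_nonneg (by positivity)]
        field_simp }
  have hVT : ∀ x, V x = (((√c)⁻¹ : ℝ) : ℂ) • T x := fun _ => rfl
  have hV : ∀ a x, V (π.π a x) = σ.π a (V x) := fun a x => by
    rw [hVT, hVT, hT, map_smul]
  have hsurj : Function.Surjective V := by
    refine LinearMap.range_eq_top.1 ((hσ.eq_bot_or_eq_top (LinearMap.range V.toLinearMap)
      V.isometry.isClosedEmbedding.isClosed_range ?_).resolve_left fun h => ?_)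
    · rintro a _ ⟨x, rfl⟩
      exact ⟨π.π a x, hV a x⟩
    · have h1 : V x₀ ∈ LinearMap.range V.toLinearMap := ⟨x₀, rfl⟩
      rw [h, Submodule.mem_bot, hVT] at h1
      exact hx₀ ((smul_eq_zero.1 h1).resolve_left (by exact_mod_cast (inv_pos.2 hs).ne'))
  exact ⟨LinearIsometryEquiv.ofSurjective V hsurj, hV⟩

/-! ### Pure states and irreducibility -/

theorem norm_sq_eq_re_of_vectorFunctional_eq {π : A →⋆ₐ[ℂ] (H →L[ℂ] H)} {x : H}
    {φ : StrongDual ℂ A} (h : vectorFunctional π x = φ) (a : A) :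
    ‖π a x‖ ^ 2 = (φ (star a * a)).re := by
  rw [← h, vectorFunctional_star_mul_self, Complex.ofReal_re]

/-- A state dominated by a multiple of a vector state of an irreducible representation is equal to
that vector state. -/
theorem Rep.IsIrreducible.eq_vectorFunctional {π : Rep.{u, w} A} (hπ : π.IsIrreducible) {ξ : π.H}
    (hξ : ‖ξ‖ = 1) {ψ : StrongDual ℂ A} (hψ : ψ ∈ stateSpace A) (C : ℝ)
    (hC : ∀ a, (ψ (star a * a)).re ≤ C * ‖π.π a ξ‖ ^ 2) : ψ = vectorFunctional π.π ξ := by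
  obtain ⟨σ, η, -, -, hη⟩ := exists_gns hψ
  obtain ⟨R, hRξ, hR⟩ := exists_intertwiner π.π σ.π (ξ := ξ) (η := η)
    (hπ.denseRange_orbitMap (by rintro rfl; simp at hξ)) (√C) fun a => by
      rw [← Real.sqrt_sq (norm_nonneg (σ.π a η)), ← Real.sqrt_sq (norm_nonneg (π.π a ξ)),
        ← Real.sqrt_mul' C (sq_nonneg _), norm_sq_eq_re_of_vectorFunctional_eq hη]
      exact Real.sqrt_le_sqrt (hC a)
  obtain ⟨c, hc⟩ := hπ.exists_adjoint_apply_eq hR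
  have h : ∀ a, ψ a = c * vectorFunctional π.π ξ a := fun a => by
    rw [← hη, vectorFunctional_apply, vectorFunctional_apply, ← hRξ, ← hR,
      ← adjoint_inner_left, hc, inner_smul_left, Complex.conj_ofReal]
  have hc1 : (c : ℂ) = 1 := by
    have := h 1
    rw [hψ.1, (vectorFunctional_mem_stateSpace π.π hξ).1, mul_one] at this
    exact this.symm
  ext a
  rw [h, hc1, one_mul]

theorem Rep.IsIrreducible.vectorFunctional_mem_pureStates {π : Rep.{u, w} A}
    (hπ : π.IsIrreducible) {ξ : π.H} (hξ : ‖ξ‖ = 1) :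
    vectorFunctional π.π ξ ∈ pureStates A := by
  have key : ∀ φ₁ ∈ stateSpace A, ∀ φ₂ ∈ stateSpace A, ∀ s r : ℝ, 0 < s → 0 < r →
      s • φ₁ + r • φ₂ = vectorFunctional π.π ξ → φ₁ = vectorFunctional π.π ξ := by
    intro φ₁ h₁ φ₂ h₂ s r hs hr h
    refine hπ.eq_vectorFunctional hξ h₁ s⁻¹ fun a => ?_
    rw [norm_sq_eq_re_of_vectorFunctional_eq h.symm]
    have h2 : 0 ≤ (φ₂ (star a * a)).re := (Complex.nonneg_iff.1 (h₂.2 a)).1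
    have h3 : ((s • φ₁ + r • φ₂) (star a * a)).re
        = s * (φ₁ (star a * a)).re + r * (φ₂ (star a * a)).re := by simp
    rw [h3, mul_add, inv_mul_cancel_left₀ hs.ne']
    have : 0 ≤ s⁻¹ * (r * (φ₂ (star a * a)).re) := by positivity
    linarith
  refine mem_extremePoints.2 ⟨vectorFunctional_mem_stateSpace π.π hξ, ?_⟩
  rintro φ₁ h₁ φ₂ h₂ ⟨s, r, hs, hr, -, h⟩
  exact ⟨key φ₁ h₁ φ₂ h₂ s r hs hr h, key φ₂ h₂ φ₁ h₁ r s hr hs (by rw [add_comm, h])⟩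

theorem vectorFunctional_smul (π : A →⋆ₐ[ℂ] (H →L[ℂ] H)) (c : ℝ) (x : H) :
    vectorFunctional π ((c : ℂ) • x) = (c ^ 2 : ℝ) • vectorFunctional π x := by
  ext a
  simp
  ring

/-- A cyclic representation whose cyclic vector state is pure is irreducible: an invariant subspace
splits the state as a convex combination of vector states of the two components of the vector. -/
theorem isIrreducible_of_mem_pureStates {π : Rep.{u, w} A} {ξ : π.H} (hξ : ‖ξ‖ = 1)
    (hd : DenseRange (orbitMap π.π ξ)) (hp : vectorFunctional π.π ξ ∈ pureStates A) :
    π.IsIrreducible where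
  nontrivial := ⟨⟨ξ, 0, by rintro rfl; simp at hξ⟩⟩
  eq_bot_or_eq_top K hK hinv := by
    have : CompleteSpace K := hK.completeSpace_coe
    have hinv' : ∀ a : A, ∀ x ∈ Kᗮ, π.π a x ∈ Kᗮ := fun a x hx => by
      rw [Submodule.mem_orthogonal] at hx ⊢
      intro y hy
      rw [← star_star a, inner_map_star_right]
      exact hx _ (hinv _ y hy)
    have htop : ∀ L : Submodule ℂ π.H, IsClosed (L : Set π.H) →
        (∀ a : A, ∀ x ∈ L, π.π a x ∈ L) → ξ ∈ L → L = ⊤ := fun L hL hL' hξL =>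
      top_unique fun x _ => hL.closure_subset_iff.2
        (by rintro _ ⟨a, rfl⟩; exact hL' a ξ hξL) (hd x)
    obtain ⟨p, hpK, q, hqK, hpq⟩ := K.exists_add_mem_mem_orthogonal ξ
    by_cases hp0 : p = 0
    · left
      rw [← Submodule.orthogonal_eq_top_iff]
      exact htop _ (Submodule.isClosed_orthogonal K) hinv' (by rw [hpq, hp0, zero_add]; exact hqK)
    by_cases hq0 : q = 0
    · right
      exact htop K hK hinv (by rw [hpq, hq0, add_zero]; exact hpK)
    right
    have hpn : ‖p‖ ≠ 0 := norm_ne_zero_iff.2 hp0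
    have hqn : ‖q‖ ≠ 0 := norm_ne_zero_iff.2 hq0
    have hnorm : ‖p‖ ^ 2 + ‖q‖ ^ 2 = 1 := by
      have := norm_add_sq_eq_norm_sq_add_norm_sq_of_inner_eq_zero (𝕜 := ℂ) p q (hqK p hpK)
      rw [← hpq, hξ] at this
      nlinarith
    have hpξ : ∀ a, ⟪p, π.π a ξ⟫_ℂ = ⟪p, π.π a p⟫_ℂ := fun a => by
      rw [hpq, map_add, inner_add_right, hinv' a q hqK p hpK, add_zero]
    have hqξ : ∀ a, ⟪q, π.π a ξ⟫_ℂ = ⟪q, π.π a q⟫_ℂ := fun a => by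
      rw [hpq, map_add, inner_add_right, Submodule.inner_left_of_mem_orthogonal (hinv a p hpK) hqK,
        zero_add]
    have hunit : ∀ v : π.H, ‖v‖ ≠ 0 → ‖((‖v‖⁻¹ : ℝ) : ℂ) • v‖ = 1 := fun v hv => by
      rw [norm_smul, Complex.norm_real, norm_inv, norm_norm, inv_mul_cancel₀ hv]
    have hscale : ∀ v : π.H, ‖v‖ ≠ 0 →
        ‖v‖ ^ 2 • vectorFunctional π.π (((‖v‖⁻¹ : ℝ) : ℂ) • v) = vectorFunctional π.π v :=
      fun v hv => by
        rw [vectorFunctional_smul, smul_smul, inv_pow, mul_inv_cancel₀ (pow_ne_zero 2 hv), one_smul]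
    have hsum : vectorFunctional π.π p + vectorFunctional π.π q = vectorFunctional π.π ξ := by
      ext a
      change ⟪p, π.π a p⟫_ℂ + ⟪q, π.π a q⟫_ℂ = ⟪ξ, π.π a ξ⟫_ℂ
      rw [← hpξ, ← hqξ, ← inner_add_left, ← hpq]
    have hext := ((mem_extremePoints.1 hp).2 _
      (vectorFunctional_mem_stateSpace π.π (hunit p hpn)) _
      (vectorFunctional_mem_stateSpace π.π (hunit q hqn))
      ⟨‖p‖ ^ 2, ‖q‖ ^ 2, by positivity, by positivity, hnorm, by
        rw [hscale p hpn, hscale q hqn, hsum]⟩).1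
    have hpt : vectorFunctional π.π p = ‖p‖ ^ 2 • vectorFunctional π.π ξ := by
      rw [← hscale p hpn, hext]
    -- `p - ‖p‖² ξ` is orthogonal to the orbit of the cyclic vector `ξ`
    have hort : p - ((‖p‖ ^ 2 : ℝ) : ℂ) • ξ = 0 := by
      refine hd.eq_zero_of_inner_left ℂ ?_
      intro a
      have := congrArg (fun ψ : StrongDual ℂ A => ψ a) hpt
      simp only [vectorFunctional_apply, FunLike.coe_smul, Pi.smul_apply] at this
      simp only [orbitMap_apply]
      rw [inner_sub_left, inner_smul_left, Complex.conj_ofReal, hpξ, this, Complex.real_smul,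
        sub_self]
    refine htop K hK hinv ?_
    have : ((‖p‖ ^ 2 : ℝ) : ℂ) • ξ ∈ K := by rw [← sub_eq_zero.1 hort]; exact hpK
    exact (K.smul_mem_iff (by exact_mod_cast pow_ne_zero 2 hpn)).1 this

end Representations

/-! ### Freeness on the spectrum and intertwiners -/

section Crossed

universe u v w t

variable {A : Type u} [CStarAlgebra A] {G : Type v} [Group G] {α : G →* (A ≃⋆ₐ[ℂ] A)}

theorem IsFreeOnSpec.intertwiner_eq_zero (hfree : IsFreeOnSpec α)
    {π : Rep.{u, u} A} (hπ : π.IsIrreducible) {g : G} (hg : g ≠ 1) {T : π.H →L[ℂ] π.H}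
    (hT : ∀ a x, T (π.π a x) = π.π (α g a) (T x)) : T = 0 := by
  by_contra hne
  have heq : π.UnitaryEquiv (π.comp (α g)) :=
    hπ.unitaryEquiv (σ := π.comp (α g)) (hπ.comp (α g)) (T := T) hT hne
  have hmem : (Quotient.mk (irrepSetoid A) ⟨π, hπ⟩ : Spec A) ∈
      {x : Spec A | Spec.precomp (α g) x = x} :=
    Quotient.sound ((irrepSetoid A).symm heq)
  rw [hfree g hg] at hmem
  exact hmem

/-- Let `A ⊆ B` and let `b` in `B` satisfy `b a = α_g(a) b` for a non-trivial `g`. If the action on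
the spectrum is free, then a state of `B` extending a pure state `φ` of `A` vanishes at `a b`. With
`V` the embedding of the GNS space of `φ` into that of the extension, the compression `V* b V`
intertwines the irreducible representations `π` and `π ∘ α_g`, so it is `0` by Schur's lemma. -/
theorem IsFreeOnSpec.state_apply_mul_eq_zero (hfree : IsFreeOnSpec α) {B : Type w} [CStarAlgebra B]
    {ι : A →⋆ₐ[ℂ] B} {φ : StrongDual ℂ A} (hφ : φ ∈ pureStates A) {Φ : StrongDual ℂ B}
    (hΦ : Φ ∈ stateSpace B) (hext : ∀ a, Φ (ι a) = φ a) {g : G} (hg : g ≠ 1) {b : B}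
    (hb : ∀ a, b * ι a = ι (α g a) * b) (a : A) : Φ (ι a * b) = 0 := by
  obtain ⟨π, ξ, hξ, hd, hπφ⟩ := exists_gns hφ.1
  have hπ : π.IsIrreducible := isIrreducible_of_mem_pureStates hξ hd (hπφ ▸ hφ)
  obtain ⟨τ, η, -, -, hτΦ⟩ := exists_gns hΦ
  obtain ⟨V, hVξ, hV⟩ := exists_intertwiner π.π (τ.π.comp ι) (η := η) hd 1 fun c => by
    refine le_of_sq_le_sq ?_ (by positivity)
    rw [one_mul, norm_sq_eq_re_of_vectorFunctional_eq hπφ, StarAlgHom.comp_apply,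
      norm_sq_eq_re_of_vectorFunctional_eq hτΦ, ← map_star, ← map_mul, hext]
  have hV' : ∀ c x, V (π.π c x) = τ.π (ι c) (V x) := fun c x => by
    rw [hV, StarAlgHom.comp_apply]
  have hVad : ∀ c y, adjoint V (τ.π (ι c) y) = π.π c (adjoint V y) := fun c y => by
    rw [← adjoint_intertwines (σ := τ.π.comp ι) hV, StarAlgHom.comp_apply]
  have hT0 : adjoint V ∘L τ.π b ∘L V = 0 :=
    hfree.intertwiner_eq_zero hπ hg fun c x => by
      simp only [comp_apply]
      rw [hV', ← map_mul_apply, hb, map_mul_apply, hVad]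
  have hTξ : adjoint V (τ.π b (V ξ)) = 0 :=
    congrArg (fun S : π.H →L[ℂ] π.H => S ξ) hT0
  rw [← hτΦ, vectorFunctional_apply, map_mul_apply, ← hVξ, ← adjoint_inner_right, hVad, hTξ,
    map_zero, inner_zero_right]

/-! ### The C⋆-algebra generated by a covariant representation -/

namespace CovariantRep

@[simp]
theorem unitaryOp_apply (ρ : CovariantRep.{u, v, w} α) (g : G) (x : ρ.H) :
    ρ.unitaryOp g x = ρ.U g x := rfl

theorem unitaryOp_mul (ρ : CovariantRep.{u, v, w} α) (g h : G) :
    ρ.unitaryOp (g * h) = ρ.unitaryOp g * ρ.unitaryOp h := by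
  ext x
  simp

theorem unitaryOp_one (ρ : CovariantRep.{u, v, w} α) : ρ.unitaryOp 1 = 1 := by
  ext x
  simp

theorem star_unitaryOp (ρ : CovariantRep.{u, v, w} α) (g : G) :
    star (ρ.unitaryOp g) = ρ.unitaryOp g⁻¹ := by
  rw [star_eq_adjoint, eq_comm, eq_adjoint_iff]
  intro x y
  have h : ρ.U g (ρ.U g⁻¹ x) = x := by
    change (ρ.U g * ρ.U g⁻¹) x = x
    rw [← map_mul, mul_inv_cancel, map_one]
    rfl
  rw [unitaryOp_apply, unitaryOp_apply, ← (ρ.U g).inner_map_map, h]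

theorem unitaryOp_mul_map (ρ : CovariantRep.{u, v, w} α) (g : G) (a : A) :
    ρ.unitaryOp g * ρ.π a = ρ.π (α g a) * ρ.unitaryOp g := by
  ext x
  simp [ρ.covariant]

/-- The unitary `U_g`, as an element of the C⋆-algebra generated by `(π, U)`. -/
def gen (ρ : CovariantRep.{u, v, w} α) (g : G) : ρ.algebra :=
  ⟨ρ.unitaryOp g, StarSubalgebra.le_topologicalClosure _
    (StarAlgebra.subset_adjoin ℂ _ (Or.inr ⟨g, rfl⟩))⟩

theorem gen_mul_incl (ρ : CovariantRep.{u, v, w} α) (g : G) (a : A) :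
    ρ.gen g * ρ.incl a = ρ.incl (α g a) * ρ.gen g :=
  Subtype.ext (ρ.unitaryOp_mul_map g a)

theorem gen_one (ρ : CovariantRep.{u, v, w} α) : ρ.gen 1 = 1 := Subtype.ext ρ.unitaryOp_one

/-- The linear span of the operators `π(a) U_g`. -/
def genSpan (ρ : CovariantRep.{u, v, w} α) : Submodule ℂ (ρ.H →L[ℂ] ρ.H) :=
  Submodule.span ℂ (Set.range fun p : A × G => ρ.π p.1 * ρ.unitaryOp p.2)

theorem map_mul_unitaryOp_mem_genSpan (ρ : CovariantRep.{u, v, w} α) (a : A) (g : G) :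
    ρ.π a * ρ.unitaryOp g ∈ ρ.genSpan := Submodule.subset_span ⟨(a, g), rfl⟩

theorem mul_mem_genSpan (ρ : CovariantRep.{u, v, w} α) {x y : ρ.H →L[ℂ] ρ.H}
    (hx : x ∈ ρ.genSpan) (hy : y ∈ ρ.genSpan) : x * y ∈ ρ.genSpan := by
  have h := Submodule.mul_mem_mul hx hy
  rw [genSpan, Submodule.span_mul_span] at h
  refine Submodule.span_le.2 ?_ h
  rintro _ ⟨_, ⟨⟨a, g⟩, rfl⟩, _, ⟨⟨b, k⟩, rfl⟩, rfl⟩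
  have : ρ.π a * ρ.unitaryOp g * (ρ.π b * ρ.unitaryOp k) =
      ρ.π (a * α g b) * ρ.unitaryOp (g * k) := by
    rw [mul_assoc, ← mul_assoc (ρ.unitaryOp g), unitaryOp_mul_map, unitaryOp_mul, map_mul]
    simp only [mul_assoc]
  simp only [this]
  exact ρ.map_mul_unitaryOp_mem_genSpan _ _

theorem star_mem_genSpan (ρ : CovariantRep.{u, v, w} α) {x : ρ.H →L[ℂ] ρ.H}
    (hx : x ∈ ρ.genSpan) : star x ∈ ρ.genSpan := by
  induction hx using Submodule.span_induction with
  | mem x hx =>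
    obtain ⟨⟨a, g⟩, rfl⟩ := hx
    simp only
    rw [star_mul, star_unitaryOp, ← map_star, unitaryOp_mul_map]
    exact ρ.map_mul_unitaryOp_mem_genSpan _ _
  | zero => rw [star_zero]; exact zero_mem _
  | add x y _ _ hx hy => rw [star_add]; exact add_mem hx hy
  | smul c x _ hx => rw [star_smul]; exact Submodule.smul_mem _ _ hx

theorem adjoin_subset_genSpan (ρ : CovariantRep.{u, v, w} α) {x : ρ.H →L[ℂ] ρ.H}
    (hx : x ∈ StarAlgebra.adjoin ℂ (Set.range ρ.π ∪ Set.range ρ.unitaryOp)) :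
    x ∈ ρ.genSpan := by
  induction hx using StarAlgebra.adjoin_induction with
  | mem x hx =>
    rcases hx with ⟨a, rfl⟩ | ⟨g, rfl⟩
    · simpa [unitaryOp_one] using ρ.map_mul_unitaryOp_mem_genSpan a 1
    · simpa using ρ.map_mul_unitaryOp_mem_genSpan 1 g
  | algebraMap r =>
    rw [Algebra.algebraMap_eq_smul_one]
    refine Submodule.smul_mem _ _ ?_
    simpa [unitaryOp_one] using ρ.map_mul_unitaryOp_mem_genSpan 1 1
  | add x y _ _ hx hy => exact add_mem hx hy
  | mul x y _ _ hx hy => exact ρ.mul_mem_genSpan hx hy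
  | star x _ hx => exact ρ.star_mem_genSpan hx

/-- A bounded functional on the C⋆-algebra of a covariant representation is determined by its
values at the elements `π(a) U_g`. -/
theorem functional_ext (ρ : CovariantRep.{u, v, w} α) {Φ Ψ : StrongDual ℂ ρ.algebra}
    (h : ∀ a g, Φ (ρ.incl a * ρ.gen g) = Ψ (ρ.incl a * ρ.gen g)) : Φ = Ψ := by
  let L : Submodule ℂ (ρ.H →L[ℂ] ρ.H) :=
    (LinearMap.ker (Φ - Ψ).toLinearMap).map ρ.algebra.toSubalgebra.toSubmodule.subtype
  have hL : ρ.genSpan ≤ L := by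
    refine Submodule.span_le.2 ?_
    rintro _ ⟨⟨a, g⟩, rfl⟩
    exact ⟨ρ.incl a * ρ.gen g, sub_eq_zero.2 (h a g), rfl⟩
  have hdense : DenseRange (Set.inclusion (StarSubalgebra.le_topologicalClosure
      (StarAlgebra.adjoin ℂ (Set.range ρ.π ∪ Set.range ρ.unitaryOp)))) :=
    denseRange_inclusion_iff _ |>.2 subset_rfl
  refine DFunLike.coe_injective (hdense.equalizer Φ.continuous Ψ.continuous (funext ?_))
  rintro ⟨x, hx⟩
  obtain ⟨z, hz, rfl⟩ := hL (ρ.adjoin_subset_genSpan hx)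
  exact sub_eq_zero.1 hz

theorem state_unique (ρ : CovariantRep.{u, v, w} α) (hfree : IsFreeOnSpec α)
    {φ : StrongDual ℂ A} (hφ : φ ∈ pureStates A) {Φ Ψ : StrongDual ℂ ρ.algebra}
    (hΦ : Φ ∈ stateSpace ρ.algebra) (hΦe : ∀ a, Φ (ρ.incl a) = φ a)
    (hΨ : Ψ ∈ stateSpace ρ.algebra) (hΨe : ∀ a, Ψ (ρ.incl a) = φ a) : Φ = Ψ := by
  refine ρ.functional_ext fun a g => ?_
  by_cases hg : g = 1
  · rw [hg, gen_one, mul_one, hΦe, hΨe]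
  · rw [hfree.state_apply_mul_eq_zero hφ hΦ hΦe hg (ρ.gen_mul_incl g),
      hfree.state_apply_mul_eq_zero hφ hΨ hΨe hg (ρ.gen_mul_incl g)]

/-! ### Vector states of regular representations -/

/-- `ρ` contains the regular covariant representation induced by each representation `π` of `A`,
up to unitary equivalence. -/
def ContainsRegular (ρ : CovariantRep.{u, v, w} α) : Prop :=
  ∀ π : Rep.{u, u} A, ∃ J : lp (fun _ : G => π.H) 2 →ₗᵢ[ℂ] ρ.H,
    (∀ a x, J (diagRep (fun h => π.π.comp (α h⁻¹ : A →⋆ₐ[ℂ] A)) a x) = ρ.π a (J x)) ∧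
      ∀ g x, J (translation G π.H g x) = ρ.U g (J x)

/-- The functional on the C⋆-algebra of `ρ` given by a vector `ζ` of a regular representation. Its
value at `a U_g` is `⟪ζ, π̃(a) λ_g ζ⟫`. -/
theorem ContainsRegular.exists_functional {ρ : CovariantRep.{u, v, w} α} (hρ : ρ.ContainsRegular)
    (π : Rep.{u, u} A) (ζ : lp (fun _ : G => π.H) 2) :
    ∃ Φ : StrongDual ℂ ρ.algebra, (∀ x, 0 ≤ Φ (star x * x)) ∧
      ∀ a g, Φ (ρ.incl a * ρ.gen g) =
        ⟪ζ, diagRep (fun h => π.π.comp (α h⁻¹ : A →⋆ₐ[ℂ] A)) a (translation G π.H g ζ)⟫_ℂ := by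
  obtain ⟨J, hJ, hJU⟩ := hρ π
  refine ⟨vectorFunctional ρ.algebra.subtype (J ζ), vectorFunctional_star_mul_self_nonneg _ _,
    fun a g => ?_⟩
  rw [← J.inner_map_map, hJ, hJU]
  rfl

theorem functional_mem_stateSpace (ρ : CovariantRep.{u, v, w} α) {φ : StrongDual ℂ A}
    (hφ : φ ∈ stateSpace A) {Φ : StrongDual ℂ ρ.algebra} (hpos : ∀ x, 0 ≤ Φ (star x * x))
    (hext : ∀ a, Φ (ρ.incl a) = φ a) : Φ ∈ stateSpace ρ.algebra :=
  ⟨by rw [← map_one ρ.incl, hext, hφ.1], hpos⟩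

open Classical in
/-- The vector `ξ ⊗ δ_e` extends a vector state to a state that vanishes at `a U_g` for `g ≠ e`. -/
theorem ContainsRegular.exists_canonical_state {ρ : CovariantRep.{u, v, w} α}
    (hρ : ρ.ContainsRegular) (π : Rep.{u, u} A) {ξ : π.H} (hξ : ‖ξ‖ = 1) :
    ∃ Φ : StrongDual ℂ ρ.algebra, Φ ∈ stateSpace ρ.algebra ∧
      (∀ a, Φ (ρ.incl a) = vectorFunctional π.π ξ a) ∧
      ∀ a, ∀ g ≠ 1, Φ (ρ.incl a * ρ.gen g) = 0 := by
  obtain ⟨Φ, hpos, hΦ⟩ := hρ.exists_functional π (lp.single 2 1 ξ)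
  have hext : ∀ a, Φ (ρ.incl a) = vectorFunctional π.π ξ a := fun a => by
    have := hΦ a 1
    rw [gen_one, mul_one] at this
    rw [this, lp.inner_single_left]
    simp
  refine ⟨Φ, ρ.functional_mem_stateSpace (vectorFunctional_mem_stateSpace _ hξ) hpos hext, hext,
    fun a g hg => ?_⟩
  rw [hΦ, lp.inner_single_left, diagRep_apply, translation_apply, lp.single_apply_ne]
  · simp
  · simpa using hg

open Classical in
/-- If `U` implements an equivalence of `π ∘ α_g` and `π`, then for `|c| = 1` the vector
`(ξ ⊗ δ_e + c U⁻¹ξ ⊗ δ_{g⁻¹}) / √2` also extends the vector state of `ξ`. Its value at `a U_{g⁻¹}`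
is a combination of `c` and its conjugate. -/
theorem ContainsRegular.exists_twisted_state {ρ : CovariantRep.{u, v, w} α}
    (hρ : ρ.ContainsRegular) (π : Rep.{u, u} A) {ξ : π.H} (hξ : ‖ξ‖ = 1) {g : G} (hg : g ≠ 1)
    (U : π.H ≃ₗᵢ[ℂ] π.H) (hU : ∀ a x, U (π.π (α g a) x) = π.π a (U x)) (a : A) :
    ∃ X : ℂ, ∀ c : ℂ, ‖c‖ = 1 → ∃ Φ : StrongDual ℂ ρ.algebra, Φ ∈ stateSpace ρ.algebra ∧
      (∀ b, Φ (ρ.incl b) = vectorFunctional π.π ξ b) ∧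
      Φ (ρ.incl a * ρ.gen g⁻¹) =
        (2 : ℂ)⁻¹ * (c * X + starRingEnd ℂ c * ⟪U.symm ξ, π.π (α g a) ξ⟫_ℂ) := by
  have hg' : g⁻¹ ≠ 1 := inv_ne_one.2 hg
  let ω : lp (fun _ : G => π.H) 2 := lp.single 2 g⁻¹ (U.symm ξ)
  refine ⟨⟪ξ, π.π a (ω g)⟫_ℂ, fun c hc => ?_⟩
  obtain ⟨Φ, hpos, hΦ⟩ := hρ.exists_functional π (lp.single 2 1 ξ + c • ω)
  let f : G → π.H := fun h => (lp.single 2 1 ξ + c • ω : lp (fun _ : G => π.H) 2) h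
  have hval : ∀ b k, Φ (ρ.incl b * ρ.gen k) = ⟪ξ, π.π b (f k⁻¹)⟫_ℂ +
      starRingEnd ℂ c * ⟪U.symm ξ, π.π (α g b) (f (k⁻¹ * g⁻¹))⟫_ℂ := by
    intro b k
    rw [hΦ, inner_add_left, inner_smul_left, lp.inner_single_left, lp.inner_single_left]
    change ⟪ξ, π.π (α 1⁻¹ b) (f (k⁻¹ * 1))⟫_ℂ +
      starRingEnd ℂ c * ⟪U.symm ξ, π.π (α g⁻¹⁻¹ b) (f (k⁻¹ * g⁻¹))⟫_ℂ = _
    simp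
  have hf : ∀ h, f h = (lp.single 2 1 ξ : lp (fun _ : G => π.H) 2) h + c • ω h := fun _ => rfl
  have hf1 : f 1 = ξ := by
    rw [hf, lp.single_apply_self, lp.single_apply_ne _ _ _ hg'.symm, smul_zero, add_zero]
  have hfg : f g = c • ω g := by
    rw [hf, lp.single_apply_ne _ _ _ hg, zero_add]
  have hfg' : f g⁻¹ = c • U.symm ξ := by
    rw [hf, lp.single_apply_ne _ _ _ hg', lp.single_apply_self, zero_add]
  have hcc : starRingEnd ℂ c * c = 1 := by
    rw [mul_comm, Complex.mul_conj, Complex.normSq_eq_norm_sq, hc]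
    simp
  have hext : ∀ b, ((2 : ℂ)⁻¹ • Φ) (ρ.incl b) = vectorFunctional π.π ξ b := fun b => by
    have h1 := hval b 1
    have h2 : ⟪U.symm ξ, π.π (α g b) (U.symm ξ)⟫_ℂ = ⟪ξ, π.π b ξ⟫_ℂ := by
      rw [← U.inner_map_map, hU, U.apply_symm_apply]
    rw [gen_one, mul_one, inv_one, one_mul, hf1, hfg', map_smul, inner_smul_right, h2,
      ← mul_assoc, hcc] at h1
    rw [FunLike.coe_smul, Pi.smul_apply, h1, vectorFunctional_apply, smul_eq_mul]
    ring
  refine ⟨(2 : ℂ)⁻¹ • Φ, ρ.functional_mem_stateSpace (vectorFunctional_mem_stateSpace _ hξ)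
    (fun x => ?_) hext, hext, ?_⟩
  · rw [FunLike.coe_smul, Pi.smul_apply, smul_eq_mul]
    exact mul_nonneg (by simp) (hpos x)
  · rw [FunLike.coe_smul, Pi.smul_apply, hval, smul_eq_mul, inv_inv,
      mul_inv_cancel, hf1, hfg, map_smul, inner_smul_right]

/-- For every covariant representation that contains the regular ones, in particular for both
crossed products, the pure extension property is freeness on the spectrum. -/
theorem ContainsRegular.hasPEP_iff {ρ : CovariantRep.{u, v, w} α} (hρ : ρ.ContainsRegular) :
    HasPEP ρ.incl ↔ IsFreeOnSpec α := by
  constructor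
  · intro hPEP g hg
    rw [Set.eq_empty_iff_forall_notMem]
    intro x
    induction x using Quotient.inductionOn with
    | h p =>
    obtain ⟨π, hπ⟩ := p
    intro hfix
    obtain ⟨U, hU⟩ : (π.comp (α g)).UnitaryEquiv π := Quotient.exact hfix
    change π.H ≃ₗᵢ[ℂ] π.H at U
    have hU' : ∀ a x, U (π.π (α g a) x) = π.π a (U x) := hU
    have := hπ.nontrivial
    obtain ⟨ξ, hξ⟩ := exists_norm_eq π.H zero_le_one
    have hξ0 : ξ ≠ 0 := by rintro rfl; simp at hξ
    obtain ⟨Φ₀, h₀, h₀e, h₀g⟩ := hρ.exists_canonical_state π hξ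
    have huniq := hPEP _ (hπ.vectorFunctional_mem_pureStates hξ)
    have hzero : ∀ a, ⟪U.symm ξ, π.π (α g a) ξ⟫_ℂ = 0 := fun a => by
      obtain ⟨X, hX⟩ := hρ.exists_twisted_state π hξ hg U hU' a
      have hc : ∀ c : ℂ, ‖c‖ = 1 →
          c * X + starRingEnd ℂ c * ⟪U.symm ξ, π.π (α g a) ξ⟫_ℂ = 0 := fun c hc => by
        obtain ⟨Φ, hΦ, hΦe, hΦg⟩ := hX c hc
        rw [huniq.unique ⟨hΦ, hΦe⟩ ⟨h₀, h₀e⟩, h₀g _ _ (inv_ne_one.2 hg)] at hΦg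
        simpa using hΦg.symm
      -- the coefficients of `c` and of its conjugate are separated by `c = 1` and `c = i`
      have h1 := hc 1 (by simp)
      have hI := hc Complex.I (by simp)
      simp only [map_one, one_mul, Complex.conj_I] at h1 hI
      linear_combination (1 / 2 : ℂ) * h1 + (Complex.I / 2) * hI +
        (⟪U.symm ξ, π.π (α g a) ξ⟫_ℂ - X) / 2 * Complex.I_sq
    have h0 : U.symm ξ = 0 := by
      refine (hπ.denseRange_orbitMap hξ0).eq_zero_of_inner_left ℂ fun a => ?_
      rw [orbitMap_apply, ← (α g).apply_symm_apply a]
      exact hzero _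
    exact hξ0 (by simpa using h0)
  · intro hfree φ hφ
    obtain ⟨π, ξ, hξ, -, rfl⟩ := exists_gns hφ.1
    obtain ⟨Φ, hΦ, hΦe, -⟩ := hρ.exists_canonical_state π hξ
    exact ⟨Φ, ⟨hΦ, hΦe⟩, fun Ψ hΨ => ρ.state_unique hfree hφ hΨ.1 hΨ.2 hΦ hΦe⟩

/-! ### The full and the reduced crossed product -/

end CovariantRep

open Classical in
/-- Each summand sits in a direct sum of representations as an invariant subspace. -/
theorem exists_isometry_diag {I : Type t} {H : I → Type w} [∀ i, NormedAddCommGroup (H i)]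
    [∀ i, InnerProductSpace ℂ (H i)] [∀ i, CompleteSpace (H i)]
    (φ : ∀ i, A →⋆ₐ[ℂ] (H i →L[ℂ] H i)) (U : ∀ i, G →* (H i ≃ₗᵢ[ℂ] H i)) (i : I) :
    ∃ J : H i →ₗᵢ[ℂ] lp H 2, (∀ a x, J (φ i a x) = diagRep φ a (J x)) ∧
      ∀ g x, J (U i g x) = diagUnitary U g (J x) := by
  let J : H i →ₗᵢ[ℂ] lp H 2 :=
    { toLinearMap := (lp.singleContinuousLinearMap ℂ H 2 i).toLinearMap
      norm_map' := fun x => lp.norm_single (E := H) (p := 2) (by norm_num) i x }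
  have hJ : ∀ x j, J x j = Pi.single i x j := fun _ _ => rfl
  refine ⟨J, fun a x => ?_, fun g x => ?_⟩
  · refine lp.ext (funext fun j => ?_)
    rw [diagRep_apply, hJ, hJ, Pi.apply_single (fun j => ⇑(φ j a)) (fun j => map_zero _)]
  · refine lp.ext (funext fun j => ?_)
    rw [diagUnitary_apply, hJ, hJ, Pi.apply_single (fun j => ⇑(U j g)) (fun j => map_zero _)]

theorem containsRegular_fullRep (α : G →* (A ≃⋆ₐ[ℂ] A)) : (fullRep α).ContainsRegular :=
  fun π => exists_isometry_diag (fun ρ : CovariantRep.{u, v, max u v} α => ρ.π) (fun ρ => ρ.U)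
    (CovariantRep.regular α π)

theorem containsRegular_reducedRep (α : G →* (A ≃⋆ₐ[ℂ] A)) : (reducedRep α).ContainsRegular :=
  fun π => exists_isometry_diag (fun π : Rep.{u, u} A => (CovariantRep.regular α π).π)
    (fun π => (CovariantRep.regular α π).U) π

end Crossed

end CrossedPEP

end

theorem theorem2p4 {A : Type*} [CStarAlgebra A] {G : Type*} [Group G]
    (α : G →* (A ≃⋆ₐ[ℂ] A)) :
    List.TFAE [CrossedPEP.HasPEP (CrossedPEP.fullIncl α),
      CrossedPEP.HasPEP (CrossedPEP.reducedIncl α),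
      CrossedPEP.IsFreeOnSpec α] := by
  have h₁ := (CrossedPEP.containsRegular_fullRep α).hasPEP_iff
  have h₂ := (CrossedPEP.containsRegular_reducedRep α).hasPEP_iff
  tfae_have 1 ↔ 3 := h₁
  tfae_have 2 ↔ 3 := h₂
  tfae_finish
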